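/- Let $\Delta$ be a (finite, reduced, crystallographic) root system spanning the finite-dimensional real vector space $E$, let $\Sigma$ be a base of $\Delta$, and let $J\subsetneq\Sigma$. Let $R=\Delta/J$ be the corresponding quotient root system (QRS), i.e. the set of nonzero images of the elements of $\Delta$ in $V=E/\operatorname{span}J$. Let $S$ be a base of $R$: a subset of $R$ which is a basis of $V$ such that every element of $R$ is an integral combination of elements of $S$ with all coefficients non-negative or all coefficients non-positive; let $R^+$ be the set of elements of $R$ whose coefficients are all non-negative. A subset $\Phi\subseteq R^+$ is called an inversion set if both $\Phi$ and $R^+\setminus\Phi$ are closed, where a set $A \subseteq R^+$ is closed if $\alpha+\beta\in A$ whenever $\alpha,\beta\in A$ and $\alpha+\beta\in R$. For $I\subseteq S$ let $\pi_I:V\to V/\operatorname{span}I$ be the projection, $R_I^+=R^+\cap\operatorname{span}I$ and $(R/I)^+=\pi_I(R^+)\setminus\{0\}$; for $\Psi\subseteq (R/I)^+$ and $X\subseteq R_I^+$ the inflation of $\Psi$ by $X$ from $I$ is $\inf_I^S(\Psi,X)=\{\alpha\in R^+ : \pi_I(\alpha)\in\Psi\}\cup X$. A subset $\Phi\subseteq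 R^+$ is called primitive if $\Phi\neq\emptyset$, $\Phi\neq R^+$, and $\Phi=\inf_I^S(\Psi,X)$ (with $I$, $\Psi$, $X$ as above) implies $I=\emptyset$ or $I=S$. A nonempty inversion set $\Phi$ is called irreducible if, whenever $\Phi=\Phi_1\cup\Phi_2$ is a disjoint union of two inversion sets, then $\Phi_1=\Phi$ or $\Phi_2=\Phi$. Then every primitive inversion set $\Phi\subseteq R^+$ is irreducible; that is, it cannot be written as a disjoint union of two nonempty inversion sets. -/

import Mathlib

namespace QuotientRootSystem

/-- For a set `A` of vectors and a set `I`, the set `A / I` of the nonzero images of the elements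
of `A` under the canonical projection `π_I : V → V / span I`. -/
def quotientSet {V : Type*} [AddCommGroup V] [Module ℝ V] (A I : Set V) :
    Set (V ⧸ Submodule.span ℝ I) :=
  {x | x ≠ 0 ∧ ∃ a ∈ A, (Submodule.span ℝ I).mkQ a = x}

/-- `S` is a base of the set of roots `R ⊆ V`: it consists of roots, it is a basis of `V`, and
every root is an integral combination of elements of `S` with all coefficients non-negative or
all coefficients non-positive. -/
structure IsBase {V : Type*} [AddCommGroup V] [Module ℝ V] (R S : Set V) : Prop where
  subset : S ⊆ R
  linearIndepOn : LinearIndepOn ℝ id S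
  span_eq_top : Submodule.span ℝ S = ⊤
  mem_or_neg_mem : ∀ α ∈ R, α ∈ AddSubmonoid.closure S ∨ -α ∈ AddSubmonoid.closure S

/-- The set `R⁺` of roots in `R` that are positive with respect to the base `S`. -/
def posRoots {V : Type*} [AddCommGroup V] [Module ℝ V] (R S : Set V) : Set V :=
  {α | α ∈ R ∧ α ∈ AddSubmonoid.closure S}

/-- `Φ` is closed in `R`: a sum of two elements of `Φ` lies in `Φ` whenever it is a root. -/
def IsClosedIn {V : Type*} [AddCommGroup V] (R Φ : Set V) : Prop :=
  ∀ α ∈ Φ, ∀ β ∈ Φ, α + β ∈ R → α + β ∈ Φ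

/-- `Φ` is an inversion set: a subset of `R⁺` that is closed and co-closed. -/
structure IsInversionSet {V : Type*} [AddCommGroup V] [Module ℝ V] (R S Φ : Set V) : Prop where
  subset : Φ ⊆ posRoots R S
  closed : IsClosedIn R Φ
  coclosed : IsClosedIn R (posRoots R S \ Φ)

/-- The inflation `inf_I^S(Ψ, X) = π_I⁻¹(Ψ) ∪ X`, where the preimage is taken in `R⁺`. -/
def inflation {V : Type*} [AddCommGroup V] [Module ℝ V] (R S I : Set V)
    (Ψ : Set (V ⧸ Submodule.span ℝ I)) (X : Set V) : Set V :=
  {α | α ∈ posRoots R S ∧ (Submodule.span ℝ I).mkQ α ∈ Ψ} ∪ X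

/-- `Φ ⊆ R⁺` is primitive: it is neither empty nor all of `R⁺`, and whenever `Φ` is the inflation
from some `I ⊆ S` of some `Ψ ⊆ (R / I)⁺` by some `X ⊆ R_I⁺ = R⁺ ∩ span I`, then `I = ∅` or
`I = S`. -/
structure IsPrimitive {V : Type*} [AddCommGroup V] [Module ℝ V] (R S Φ : Set V) : Prop where
  subset : Φ ⊆ posRoots R S
  ne_empty : Φ ≠ ∅
  ne_posRoots : Φ ≠ posRoots R S
  eq_or_eq : ∀ I : Set V, I ⊆ S →
    ∀ Ψ : Set (V ⧸ Submodule.span ℝ I), Ψ ⊆ quotientSet (posRoots R S) I →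
    ∀ X : Set V, X ⊆ posRoots R S ∩ Submodule.span ℝ I →
    Φ = inflation R S I Ψ X → I = ∅ ∨ I = S

/-- `Φ` is irreducible: a nonempty inversion set such that, whenever `Φ` is the disjoint union of
two inversion sets, one of the two is `Φ` itself. -/
structure IsIrreducible {V : Type*} [AddCommGroup V] [Module ℝ V] (R S Φ : Set V) : Prop where
  nonempty : Φ.Nonempty
  isInversionSet : IsInversionSet R S Φ
  eq_or_eq : ∀ Φ₁ Φ₂ : Set V, IsInversionSet R S Φ₁ → IsInversionSet R S Φ₂ →
    Disjoint Φ₁ Φ₂ → Φ = Φ₁ ∪ Φ₂ → Φ₁ = Φ ∨ Φ₂ = Φ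

end QuotientRootSystem

/-!
Let `Φ = Φ₁ ∪ Φ₂` be a disjoint union of two nonempty inversion sets, `Φ ≠ R⁺`. Colour the positive
roots according to whether they lie in `Φ₁`, in `Φ₂` or outside `Φ`. Since `Φ₁` and `Φ₂` are
co-closed and `Φ` is closed, a sum of two positive roots always has the colour of one of its
summands (`IsColouring`), and all three colours occur. It is shown that for any such colouring with
at least three colours there is a nonempty proper subset `I` of the base `S` such that the colour of
a root outside `span I` depends only on its class modulo `span I`
(`IsRootLike.exists_subset_colour_eq`). Hence `Φ` is an inflation from `I`, and is not primitive.

The argument uses few properties of a quotient root system: there is an inner product for which a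
sum of two roots at an obtuse angle is a root or zero, and two orthogonal roots whose sum is a root
have a difference that is a root or zero (`IsRootLike`). They are inherited from the root system
(`exists_isRootLike`), because the sum of the roots in a coset of `span J` is orthogonal to `J`, so
that the inner product of two classes is an average of inner products of representatives.

The main tool is propagation along chains. If a simple root `s` occurs in a root of colour `d`, and
`y` is such a root of minimal height, then in every chain of positive roots from a root in which `s`
occurs to `y` the last step has colour `d`. In a shortest chain that step can be performed first
(`IsRootLike.reach_move_front`). So a property of `s` that is preserved by adding roots of colour
`d` holds for some root of colour `d` (`IsRootLike.exists_of_colour`). This is applied twice.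

* If `I` is the set of simple roots occurring in roots of colour `d`, then adding an element of `I`
  to a root outside `span I` does not change its colour (`IsRootLike.colour_add_simple`). As the
  positive roots in a coset of `span I` are connected by such steps, `I` has the required property,
  except that it may be all of `S`.
* If `x` is a highest root among those avoiding a colour, and `x + s` is a root with `s` simple, then
  `s` does not occur in any root of a third colour (`IsRootLike.notMem_colourSupport`). This makes
  `I` a proper subset of `S` for a suitable colour.

If `x + s` is never a root for `x` the highest root that avoids the colour of a root `θ` of maximal
height, then `θ` is supported on a proper component of `S`, which serves as `I`.
-/

namespace QuotientRootSystem

section RootLike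

variable {V : Type*} [AddCommGroup V] [Module ℝ V] {B : LinearMap.BilinForm ℝ V} {R S : Set V}

/-! ### Sets of vectors with the sum properties of a quotient root system -/

/-- The properties of a quotient root system `R` on which the argument rests: `R` is finite,
symmetric, does not contain zero, and there is an inner product `B` for which obtuse pairs of roots
can be added, and for which two orthogonal roots whose sum is a root have a difference in
`R ∪ {0}`. -/
structure IsRootLike (B : LinearMap.BilinForm ℝ V) (R : Set V) : Prop where
  finite : R.Finite
  zero_notMem : (0 : V) ∉ R
  neg_mem : ∀ a ∈ R, -a ∈ R
  symm : ∀ x y, B x y = B y x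
  pos : ∀ x, x ≠ 0 → 0 < B x x
  add_mem_of_neg : ∀ a ∈ R, ∀ b ∈ R, B a b < 0 → a + b = 0 ∨ a + b ∈ R
  sub_mem_of_orthogonal : ∀ a ∈ R, ∀ b ∈ R, B a b = 0 → a + b ∈ R → a - b = 0 ∨ a - b ∈ R

namespace IsRootLike

lemma sub_mem_of_pos (hR : IsRootLike B R) {a b : V} (ha : a ∈ R) (hb : b ∈ R) (h : 0 < B a b) :
    a - b = 0 ∨ a - b ∈ R := by
  rw [sub_eq_add_neg]
  exact hR.add_mem_of_neg a ha (-b) (hR.neg_mem b hb) (by simpa using h)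

lemma ne_zero (hR : IsRootLike B R) {a : V} (ha : a ∈ R) : a ≠ 0 := by
  rintro rfl
  exact hR.zero_notMem ha

/-- The last summand of a root `r + v + w` with `r + v` a root can be moved next to `r` or
next to `v`. -/
lemma add_mem_or_add_mem (hR : IsRootLike B R) {r v w : V} (hr : r ∈ R) (hv : v ∈ R)
    (hw : w ∈ R) (hrv : r + v ∈ R) (hrvw : r + v + w ∈ R) :
    (r + w = 0 ∨ r + w ∈ R) ∨ (v + w = 0 ∨ v + w ∈ R) := by
  by_contra hcon
  obtain ⟨h1, h2⟩ := not_or.1 hcon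
  have e1 : r + v + w - v = r + w := by abel
  have e2 : r + v + w - r = v + w := by abel
  have b1 : B (r + v + w) v ≤ 0 := by
    by_contra h
    exact h1 (e1 ▸ hR.sub_mem_of_pos hrvw hv (not_le.1 h))
  have b2 : B (r + v + w) r ≤ 0 := by
    by_contra h
    exact h2 (e2 ▸ hR.sub_mem_of_pos hrvw hr (not_le.1 h))
  have b3 : 0 ≤ B r w := by
    by_contra h
    exact h1 (hR.add_mem_of_neg r hr w hw (not_le.1 h))
  have b4 : 0 ≤ B v w := by
    by_contra h
    exact h2 (hR.add_mem_of_neg v hv w hw (not_le.1 h))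
  have b5 := hR.pos _ (hR.ne_zero hrv)
  have s1 := hR.symm v w
  have s2 := hR.symm r w
  simp only [map_add, LinearMap.add_apply] at b1 b2 b5
  linarith

/-- If `p + u` and `u + v` are roots but `p + u + v` is not, then `p - v` is a root or zero. -/
lemma sub_mem_of_add_notMem (hR : IsRootLike B R) {p u v : V} (hp : p ∈ R) (hu : u ∈ R)
    (hv : v ∈ R) (hpu : p + u ∈ R) (huv : u + v ∈ R) (h : ¬ (p + u + v = 0 ∨ p + u + v ∈ R)) :
    p - v = 0 ∨ p - v ∈ R := by
  by_contra hcon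
  have b1 : B p v ≤ 0 := by
    by_contra h
    exact hcon (hR.sub_mem_of_pos hp hv (not_le.1 h))
  have e : p + u - (u + v) = p - v := by abel
  have b2 : B (p + u) (u + v) ≤ 0 := by
    by_contra h
    exact hcon (e ▸ hR.sub_mem_of_pos hpu huv (not_le.1 h))
  have b3 : 0 ≤ B (p + u) v := by
    by_contra h'
    exact h (hR.add_mem_of_neg _ hpu v hv (not_le.1 h'))
  have b4 : 0 ≤ B p (u + v) := by
    by_contra h'
    exact h (add_assoc p u v ▸ hR.add_mem_of_neg p hp _ huv (not_le.1 h'))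
  have b5 := hR.pos _ (hR.ne_zero hu)
  simp only [map_add, LinearMap.add_apply] at b2 b3 b4
  linarith

end IsRootLike

/-! ### Coordinates and heights with respect to a base -/

/-- The basis of the ambient space given by a base of `R`. -/
noncomputable def IsBase.basis (hS : IsBase R S) : Module.Basis S ℝ V :=
  Module.Basis.mk (v := fun s : S => (s : V)) hS.linearIndepOn
    (by rw [Subtype.range_coe, hS.span_eq_top])

/-- The coefficient of `s ∈ S` in a vector. -/
noncomputable def IsBase.coord (hS : IsBase R S) (s : S) : V →ₗ[ℝ] ℝ := hS.basis.coord s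

/-- The height of a vector, the sum of its coefficients. -/
noncomputable def IsBase.height (hS : IsBase R S) : V →ₗ[ℝ] ℝ :=
  hS.basis.constr ℝ (fun _ => (1 : ℝ))

namespace IsBase

lemma basis_apply (hS : IsBase R S) (s : S) : hS.basis s = s := Module.Basis.mk_apply _ _ s

lemma coord_self (hS : IsBase R S) (s : S) : hS.coord s (s : V) = 1 := by
  rw [coord, ← hS.basis_apply]; simp

lemma coord_of_ne (hS : IsBase R S) {s t : S} (h : t ≠ s) : hS.coord s (t : V) = 0 := by
  rw [coord, ← hS.basis_apply]; simp [h]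

lemma height_simple (hS : IsBase R S) {s : V} (hs : s ∈ S) : hS.height s = 1 := by
  have h := hS.basis.constr_basis ℝ (fun _ => (1 : ℝ)) ⟨s, hs⟩
  rwa [hS.basis_apply] at h

lemma coord_nonneg (hS : IsBase R S) (s : S) {x : V} (hx : x ∈ AddSubmonoid.closure S) :
    0 ≤ hS.coord s x := by
  induction hx using AddSubmonoid.closure_induction with
  | mem t ht =>
    by_cases h : (⟨t, ht⟩ : S) = s
    · subst h
      exact (hS.coord_self ⟨t, ht⟩).symm ▸ zero_le_one
    · exact (hS.coord_of_ne h).ge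
  | zero => simp
  | add a b _ _ ha hb => rw [map_add]; exact add_nonneg ha hb

lemma eq_zero_or_one_le_height (hS : IsBase R S) {x : V} (hx : x ∈ AddSubmonoid.closure S) :
    x = 0 ∨ 1 ≤ hS.height x := by
  induction hx using AddSubmonoid.closure_induction with
  | mem t ht => exact Or.inr (hS.height_simple ht).ge
  | zero => exact Or.inl rfl
  | add a b _ _ ha hb =>
    rcases ha with rfl | ha
    · simpa using hb
    · rcases hb with rfl | hb
      · right; simpa using ha
      · right; rw [map_add]; linarith

lemma mem_span_iff (hS : IsBase R S) {I : Set V} (hI : I ⊆ S) {x : V} :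
    x ∈ Submodule.span ℝ I ↔ ∀ s : S, (s : V) ∉ I → hS.coord s x = 0 := by
  have e : I = hS.basis '' {s : S | (s : V) ∈ I} := by
    ext y
    constructor
    · intro hy
      exact ⟨⟨y, hI hy⟩, hy, hS.basis_apply _⟩
    · rintro ⟨s, hs, rfl⟩
      rwa [hS.basis_apply]
  conv_lhs => rw [e, hS.basis.mem_span_image]
  constructor
  · intro h s hs
    by_contra h0
    exact hs (h (Finsupp.mem_support_iff.2 h0))
  · intro h s hs
    by_contra h0
    exact Finsupp.mem_support_iff.1 hs (h s h0)

/-- The cone spanned by a subset of the base is a face of the cone spanned by the base. -/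
lemma mem_span_of_add_mem_span (hS : IsBase R S) {I : Set V} (hI : I ⊆ S) {x y : V}
    (hx : x ∈ AddSubmonoid.closure S) (hy : y ∈ AddSubmonoid.closure S)
    (hxy : x + y ∈ Submodule.span ℝ I) : x ∈ Submodule.span ℝ I := by
  rw [hS.mem_span_iff hI] at hxy ⊢
  intro s hs
  have h := hxy s hs
  rw [map_add] at h
  linarith [hS.coord_nonneg s hx, hS.coord_nonneg s hy]

lemma coord_pos_of_add (hS : IsBase R S) (s : S) {x y : V} (hx : 0 < hS.coord s x)
    (hy : y ∈ AddSubmonoid.closure S) : 0 < hS.coord s (x + y) := by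
  rw [map_add]
  linarith [hS.coord_nonneg s hy]

lemma mem_posRoots (hS : IsBase R S) {s : V} (hs : s ∈ S) : s ∈ posRoots R S :=
  ⟨hS.subset hs, AddSubmonoid.subset_closure hs⟩

end IsBase

lemma add_mem_posRoots {x y : V} (hx : x ∈ posRoots R S) (hy : y ∈ posRoots R S)
    (h : x + y ∈ R) : x + y ∈ posRoots R S :=
  ⟨h, add_mem hx.2 hy.2⟩

/-! ### Positive roots -/

namespace IsRootLike

lemma height_ge_one (hR : IsRootLike B R) (hS : IsBase R S) {x : V} (hx : x ∈ posRoots R S) :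
    1 ≤ hS.height x :=
  (hS.eq_zero_or_one_le_height hx.2).resolve_left (hR.ne_zero hx.1)

lemma add_ne_zero (hR : IsRootLike B R) (hS : IsBase R S) {x y : V} (hx : x ∈ posRoots R S)
    (hy : y ∈ posRoots R S) : x + y ≠ 0 := by
  intro h
  have h1 := congrArg hS.height h
  rw [map_add, map_zero] at h1
  linarith [hR.height_ge_one hS hx, hR.height_ge_one hS hy]

lemma eq_or_sub_mem_or_sub_mem (hR : IsRootLike B R) (hS : IsBase R S) {x y : V}
    (h : x - y = 0 ∨ x - y ∈ R) : x = y ∨ x - y ∈ posRoots R S ∨ y - x ∈ posRoots R S := by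
  rcases h with h | h
  · exact Or.inl (sub_eq_zero.1 h)
  · right
    rcases hS.mem_or_neg_mem _ h with hp | hp
    · exact Or.inl ⟨h, hp⟩
    · rw [← neg_sub x y]
      exact Or.inr ⟨hR.neg_mem _ h, hp⟩

/-- A simple root can be subtracted from a positive root without leaving the positive roots,
as soon as the difference is a root. -/
lemma sub_simple_mem (hR : IsRootLike B R) (hS : IsBase R S) {x t : V} (hx : x ∈ posRoots R S)
    (ht : t ∈ S) (h : x - t = 0 ∨ x - t ∈ R) : x = t ∨ x - t ∈ posRoots R S := by
  rcases hR.eq_or_sub_mem_or_sub_mem hS h with h | h | h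
  · exact Or.inl h
  · exact Or.inr h
  · have h1 := hR.height_ge_one hS h
    rw [map_sub, hS.height_simple ht] at h1
    linarith [hR.height_ge_one hS hx]

lemma exists_simple_pos (hR : IsRootLike B R) {x : V} (hx : x ∈ posRoots R S) :
    ∃ t ∈ S, 0 < B x t := by
  by_contra! h
  have key : ∀ y ∈ AddSubmonoid.closure S, B x y ≤ 0 := by
    intro y hy
    induction hy using AddSubmonoid.closure_induction with
    | mem t ht => exact h t ht
    | zero => simp
    | add a b _ _ ha hb => rw [map_add]; linarith
  exact absurd (hR.pos x (hR.ne_zero hx.1)) (not_lt.2 (key x hx.2))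

/-- Induction on positive roots: every positive root that is not simple arises from a positive root
by adding a simple root. -/
lemma posRoots_induction (hR : IsRootLike B R) (hS : IsBase R S) {p : V → Prop}
    (simple : ∀ s ∈ S, p s)
    (add : ∀ y ∈ posRoots R S, ∀ t ∈ S, y + t ∈ posRoots R S → p y → p (y + t))
    {y : V} (hy : y ∈ posRoots R S) : p y := by
  obtain ⟨n, hn⟩ := exists_nat_gt (hS.height y)
  induction n generalizing y with
  | zero =>
    have := hR.height_ge_one hS hy
    norm_num at hn
    linarith
  | succ n ih =>
    obtain ⟨t, ht, hpos⟩ := hR.exists_simple_pos hy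
    rcases hR.sub_simple_mem hS hy ht (hR.sub_mem_of_pos hy.1 (hS.subset ht) hpos) with rfl | h
    · exact simple _ ht
    · have h1 := add (y - t) h t ht
      rw [sub_add_cancel] at h1
      refine h1 hy (ih h ?_)
      rw [map_sub, hS.height_simple ht]
      push_cast at hn
      linarith

lemma finite_posRoots (hR : IsRootLike B R) : (posRoots R S).Finite :=
  hR.finite.subset fun _ h => h.1

lemma exists_min_height (hR : IsRootLike B R) (hS : IsBase R S) {p : V → Prop}
    (h : ∃ y ∈ posRoots R S, p y) :
    ∃ y ∈ posRoots R S, p y ∧ ∀ z ∈ posRoots R S, p z → hS.height y ≤ hS.height z := by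
  obtain ⟨y, hy, hpy⟩ := h
  have hfin : (posRoots R S ∩ {y | p y}).Finite := (finite_posRoots hR).inter_of_left _
  obtain ⟨m, hm, hmin⟩ := hfin.exists_minimalFor hS.height _ ⟨y, hy, hpy⟩
  refine ⟨m, hm.1, hm.2, fun z hz hpz => ?_⟩
  by_contra hlt
  exact hlt (hmin ⟨hz, hpz⟩ (not_le.1 hlt).le)

lemma exists_max_height (hR : IsRootLike B R) (hS : IsBase R S) {p : V → Prop}
    (h : ∃ y ∈ posRoots R S, p y) :
    ∃ y ∈ posRoots R S, p y ∧ ∀ z ∈ posRoots R S, p z → hS.height z ≤ hS.height y := by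
  obtain ⟨y, hy, hpy⟩ := h
  have hfin : (posRoots R S ∩ {y | p y}).Finite := (finite_posRoots hR).inter_of_left _
  obtain ⟨m, hm, hmin⟩ := hfin.exists_maximalFor hS.height _ ⟨y, hy, hpy⟩
  refine ⟨m, hm.1, hm.2, fun z hz hpz => ?_⟩
  by_contra hlt
  exact hlt (hmin ⟨hz, hpz⟩ (not_le.1 hlt).le)

end IsRootLike

/-! ### Chains of positive roots -/

/-- `Reach R S n u y`: the root `y` is obtained from `u` by successively adding `n` positive roots,
all partial sums being roots. -/
def Reach (R S : Set V) : ℕ → V → V → Prop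
  | 0, u, y => u = y
  | n + 1, u, y => ∃ v ∈ posRoots R S, y ∈ R ∧ Reach R S n u (y - v)

lemma Reach.mem {n : ℕ} {u y : V} (hu : u ∈ posRoots R S) (h : Reach R S n u y) :
    y ∈ posRoots R S ∧ y - u ∈ AddSubmonoid.closure S := by
  induction n generalizing y with
  | zero =>
    obtain rfl : u = y := h
    exact ⟨hu, by simp⟩
  | succ n ih =>
    obtain ⟨v, hv, hy, h⟩ := h
    obtain ⟨h1, h2⟩ := ih h
    have e : y - v + v = y := by abel
    refine ⟨e ▸ add_mem_posRoots h1 hv (e.symm ▸ hy), ?_⟩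
    have e' : y - u = y - v - u + v := by abel
    exact e' ▸ add_mem h2 hv.2

namespace IsRootLike

/-- In a shortest chain the last step can be performed first: by `add_mem_or_add_mem` it can be
exchanged with its predecessor unless the two merge into one step. -/
lemma reach_move_front (hR : IsRootLike B R) (hS : IsBase R S) {n : ℕ} {u v y : V}
    (hu : u ∈ posRoots R S) (hv : v ∈ posRoots R S) (hy : y ∈ R)
    (h : Reach R S n u (y - v)) (hmin : ∀ m ≤ n, ¬ Reach R S m u y) :
    u + v ∈ R ∧ Reach R S n (u + v) y := by
  induction n generalizing y with
  | zero =>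
    have h' : u = y - v := h
    have e : u + v = y := by rw [h']; abel
    exact ⟨e.symm ▸ hy, e⟩
  | succ n ih =>
    have hr0 := (h.mem hu).1
    obtain ⟨v', hv', hr, h'⟩ := h
    have hr' := (h'.mem hu).1
    have e1 : y - v - v' + v' = y - v := by abel
    have e2 : y - v - v' + v' + v = y := by abel
    rcases hR.add_mem_or_add_mem hr'.1 hv'.1 hv.1 (e1.symm ▸ hr) (e2.symm ▸ hy) with h1 | h1
    · have h1 := h1.resolve_left (hR.add_ne_zero hS hr' hv)
      have e3 : y - v - v' + v = y - v' := by abel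
      rw [e3] at h1
      have e4 : y - v' - v = y - v - v' := by abel
      obtain ⟨g1, g2⟩ := ih h1 (e4.symm ▸ h')
        (fun m hm hm' => hmin (m + 1) (by omega) ⟨v', hv', hy, hm'⟩)
      exact ⟨g1, v', hv', hy, g2⟩
    · -- Merging the last two steps gives a shorter chain.
      have h1 := h1.resolve_left (hR.add_ne_zero hS hv' hv)
      have e3 : y - (v' + v) = y - v - v' := by abel
      exact absurd ⟨v' + v, add_mem_posRoots hv' hv h1, hy, e3.symm ▸ h'⟩ (hmin (n + 1) le_rfl)

/-- Propagation along chains: a property of `s` that is preserved by adding roots of `D` passes to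
a root `y` with positive coefficient at `s`, provided `D` contains every positive root `v` such
that `y - v` is a positive root with positive coefficient at `s`. A shortest chain from the
current root to `y` ends with a step from `D`, which is moved to the front. -/
lemma propagate_of_reach (hR : IsRootLike B R) (hS : IsBase R S) (s : S) {y : V} {D : Set V}
    (hD : ∀ v ∈ posRoots R S, y - v ∈ posRoots R S → 0 < hS.coord s (y - v) → v ∈ D)
    {Good : V → Prop}
    (step : ∀ u ∈ posRoots R S, ∀ v ∈ posRoots R S, v ∈ D → u + v ∈ posRoots R S →
      hS.height (u + v) ≤ hS.height y → Good u → Good (u + v))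
    {n : ℕ} {u : V} (hu : u ∈ posRoots R S) (hsu : 0 < hS.coord s u) (hgood : Good u)
    (h : Reach R S n u y) : Good y := by
  induction n using Nat.strong_induction_on generalizing u with
  | _ n ih =>
    by_cases hmin : ∃ m < n, Reach R S m u y
    · obtain ⟨m, hm, hm'⟩ := hmin
      exact ih m hm hu hsu hgood hm'
    · cases n with
      | zero =>
        obtain rfl : u = y := h
        exact hgood
      | succ n =>
        obtain ⟨v, hv, hy, h'⟩ := h
        obtain ⟨g1, g2⟩ := hR.reach_move_front hS hu hv hy h'
          (fun m hm hm' => hmin ⟨m, by omega, hm'⟩)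
        obtain ⟨k1, k2⟩ := h'.mem hu
        have hvD : v ∈ D := by
          refine hD v hv k1 ?_
          have e : y - v = u + (y - v - u) := by abel
          rw [e]
          exact hS.coord_pos_of_add s hsu k2
        have huv := add_mem_posRoots hu hv g1
        refine ih n (by omega) huv (hS.coord_pos_of_add s hsu hv.2)
          (step u hu v hv hvD huv ?_ hgood) g2
        have k3 := hS.eq_zero_or_one_le_height (g2.mem huv).2
        rcases k3 with k3 | k3
        · rw [sub_eq_zero.1 k3]
        · rw [map_sub] at k3; linarith

lemma exists_reach (hR : IsRootLike B R) (hS : IsBase R S) (s : S) {y : V}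
    (hy : y ∈ posRoots R S) (hsy : 0 < hS.coord s y) : ∃ n, Reach R S n (s : V) y := by
  refine hR.posRoots_induction hS (p := fun y => 0 < hS.coord s y → ∃ n, Reach R S n (s : V) y)
    ?_ ?_ hy hsy
  · intro t ht h
    by_cases hts : (⟨t, ht⟩ : S) = s
    · exact ⟨0, by rw [← hts]; rfl⟩
    · exact absurd h (hS.coord_of_ne hts).not_gt
  · intro y hy t ht hyt ih h
    by_cases hsy : 0 < hS.coord s y
    · obtain ⟨n, hn⟩ := ih hsy
      exact ⟨n + 1, t, hS.mem_posRoots ht, hyt.1, by rwa [add_sub_cancel_right]⟩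
    · by_cases hts : (⟨t, ht⟩ : S) = s
      · refine ⟨1, y, hy, hyt.1, ?_⟩
        rw [add_sub_cancel_left, ← hts]
        rfl
      · rw [map_add, hS.coord_of_ne hts, add_zero] at h
        exact absurd h hsy

end IsRootLike

/-! ### Colourings -/

/-- A colouring of the positive roots in which a sum has the colour of one of its summands. -/
def IsColouring {κ : Type*} (R S : Set V) (c : V → κ) : Prop :=
  ∀ α ∈ posRoots R S, ∀ β ∈ posRoots R S, α + β ∈ R → c (α + β) = c α ∨ c (α + β) = c β

namespace IsRootLike

/-- If a property holds for `s` and is preserved by adding roots of colour `d`, it holds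
for some root of colour `d`, provided a root of that colour has a positive coefficient at `s`:
take such a root of minimal height. -/
lemma exists_of_colour {κ : Type*} {c : V → κ} (hR : IsRootLike B R) (hS : IsBase R S)
    (hc : IsColouring R S c) (s : S) {d : κ}
    (hd : ∃ y ∈ posRoots R S, c y = d ∧ 0 < hS.coord s y) {Good : V → Prop} (base : Good s)
    (step : ∀ u ∈ posRoots R S, ∀ v ∈ posRoots R S, c v = d → u + v ∈ posRoots R S →
      (∃ y ∈ posRoots R S, c y = d ∧ hS.height (u + v) ≤ hS.height y) → Good u → Good (u + v)) :
    ∃ y ∈ posRoots R S, c y = d ∧ Good y := by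
  obtain ⟨y, hy, ⟨hyd, hsy⟩, hmin⟩ := hR.exists_min_height hS hd
  obtain ⟨n, hn⟩ := hR.exists_reach hS s hy hsy
  refine ⟨y, hy, hyd, hR.propagate_of_reach hS s (D := {v | c v = d}) ?_ ?_
    (hS.mem_posRoots s.2) (by rw [hS.coord_self]; exact one_pos) base hn⟩
  · intro v hv hyv hsyv
    have e : y - v + v = y := by abel
    have h := hc _ hyv v hv (e.symm ▸ hy.1)
    rw [e, hyd] at h
    rcases h with h | h
    · have h1 := hmin _ hyv ⟨h.symm, hsyv⟩
      rw [map_sub] at h1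
      linarith [hR.height_ge_one hS hv]
    · exact h.symm
  · intro u hu v hv hvd huv hle hg
    exact step u hu v hv hvd huv ⟨y, hy, hyd, hle⟩ hg

end IsRootLike

variable {κ : Type*} {c : V → κ}

/-! ### Colours modulo the span of the support of a colour -/

/-- The simple roots that occur in some positive root of colour `d`. -/
def colourSupport (hS : IsBase R S) (c : V → κ) (d : κ) : Set V :=
  {s | ∃ hs : s ∈ S, ∃ y ∈ posRoots R S, c y = d ∧ 0 < hS.coord ⟨s, hs⟩ y}

lemma colourSupport_subset (hS : IsBase R S) (c : V → κ) (d : κ) : colourSupport hS c d ⊆ S :=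
  fun _ h => h.1

lemma mem_span_colourSupport (hS : IsBase R S) {d : κ} {y : V} (hy : y ∈ posRoots R S)
    (hd : c y = d) : y ∈ Submodule.span ℝ (colourSupport hS c d) := by
  rw [hS.mem_span_iff (colourSupport_subset hS c d)]
  intro s hs
  by_contra h
  exact hs ⟨s.2, y, hy, hd, lt_of_le_of_ne (hS.coord_nonneg s hy.2) (Ne.symm h)⟩

namespace IsBase

lemma eq_zero_of_mem_span (hS : IsBase R S) {I : Set V} (hI : I ⊆ S) {x : V}
    (h1 : x ∈ Submodule.span ℝ I) (h2 : x ∈ Submodule.span ℝ (S \ I)) : x = 0 := by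
  refine hS.basis.ext_elem fun s => ?_
  rw [map_zero, Finsupp.zero_apply]
  by_cases hs : (s : V) ∈ I
  · exact (hS.mem_span_iff Set.sdiff_subset).1 h2 s fun h => h.2 hs
  · exact (hS.mem_span_iff hI).1 h1 s hs

/-- Two elements of the cone with difference in `span I` differ by sums of elements of `I`. -/
lemma exists_multiset_of_sub_mem_span (hS : IsBase R S) {I : Set V} (hI : I ⊆ S) {x y : V}
    (hx : x ∈ AddSubmonoid.closure S) (hy : y ∈ AddSubmonoid.closure S)
    (hxy : x - y ∈ Submodule.span ℝ I) :
    ∃ P Q : Multiset V, (∀ i ∈ P, i ∈ I) ∧ (∀ i ∈ Q, i ∈ I) ∧ x + Q.sum = y + P.sum := by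
  have hmem : ∀ {T : Set V} {z : V}, z ∈ AddSubmonoid.closure T → z ∈ Submodule.span ℝ T :=
    fun {T z} hz => (AddSubmonoid.closure_le (S := (Submodule.span ℝ T).toAddSubmonoid)).2
      Submodule.subset_span hz
  have hsplit : AddSubmonoid.closure S
      = AddSubmonoid.closure I ⊔ AddSubmonoid.closure (S \ I) := by
    rw [← AddSubmonoid.closure_union, Set.union_sdiff_cancel hI]
  rw [hsplit] at hx hy
  obtain ⟨p, hp, q, hq, rfl⟩ := AddSubmonoid.mem_sup.1 hx
  obtain ⟨p', hp', q', hq', rfl⟩ := AddSubmonoid.mem_sup.1 hy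
  have hqq : q - q' = 0 := by
    refine hS.eq_zero_of_mem_span hI ?_ (sub_mem (hmem hq) (hmem hq'))
    have e : q - q' = p + q - (p' + q') - (p - p') := by abel
    rw [e]
    exact sub_mem hxy (sub_mem (hmem hp) (hmem hp'))
  obtain ⟨P, hP, rfl⟩ := AddSubmonoid.exists_multiset_of_mem_closure hp
  obtain ⟨Q, hQ, rfl⟩ := AddSubmonoid.exists_multiset_of_mem_closure hp'
  refine ⟨P, Q, hP, hQ, ?_⟩
  rw [sub_eq_zero.1 hqq]
  abel

end IsBase

namespace IsRootLike

/-- A colour that is unchanged by steps from `I` outside `span I` is constant on the cosets of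
`span I` other than `span I` itself: the positive roots in a coset are connected by steps from `I`.
Indeed, if `γ = α - β` is the sum of `P` minus the sum of `Q`, then `B γ γ > 0` provides an element
of `P` or `Q` along which `α` or `β` can be moved closer to the other one. -/
lemma colour_eq_of_sub_mem_span (hR : IsRootLike B R) (hS : IsBase R S) {I : Set V} (hI : I ⊆ S)
    (hstep : ∀ a ∈ posRoots R S, a ∉ Submodule.span ℝ I → ∀ i ∈ I, a + i ∈ R → c (a + i) = c a)
    {α β : V} (hα : α ∈ posRoots R S) (hβ : β ∈ posRoots R S) (hαI : α ∉ Submodule.span ℝ I)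
    (hαβ : α - β ∈ Submodule.span ℝ I) : c α = c β := by
  obtain ⟨P, Q, hP, hQ, h⟩ := hS.exists_multiset_of_sub_mem_span hI hα.2 hβ.2 hαβ
  have hβI : β ∉ Submodule.span ℝ I := fun hβI => hαI (by simpa using add_mem hαβ hβI)
  clear hαβ
  obtain ⟨n, hn⟩ : ∃ n, P.card + Q.card = n := ⟨_, rfl⟩
  induction n generalizing α β P Q with
  | zero =>
    obtain ⟨h1, h2⟩ := Nat.add_eq_zero_iff.1 hn
    rw [Multiset.card_eq_zero] at h1 h2
    subst h1 h2
    rw [add_left_injective _ h]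
  | succ n ih =>
    -- Given `i ∈ P` with `B (α - β) i > 0`, either `α - i` or `β + i` is a root. The case of an
    -- element of `Q` follows by exchanging `α` and `β`.
    have key : ∀ {α β : V}, α ∈ posRoots R S → β ∈ posRoots R S → α ∉ Submodule.span ℝ I →
        β ∉ Submodule.span ℝ I → ∀ P Q : Multiset V, (∀ i ∈ P, i ∈ I) → (∀ i ∈ Q, i ∈ I) →
        α + Q.sum = β + P.sum → P.card + Q.card = n + 1 → ∀ i ∈ P, 0 < B (α - β) i →
        c α = c β := by
      intro α β hα hβ hαI hβI P Q hP hQ h hn i hiP hpos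
      obtain ⟨P, rfl⟩ := Multiset.exists_cons_of_mem hiP
      have hi := hP i hiP
      have hiI : i ∈ Submodule.span ℝ I := Submodule.subset_span hi
      have hP' : ∀ j ∈ P, j ∈ I := fun j hj => hP j (Multiset.mem_cons_of_mem hj)
      rw [Multiset.card_cons] at hn
      rw [Multiset.sum_cons] at h
      rw [map_sub, LinearMap.sub_apply] at hpos
      by_cases hαi : 0 < B α i
      · rcases hR.sub_simple_mem hS hα (hI hi) (hR.sub_mem_of_pos hα.1 (hS.subset (hI hi)) hαi)
          with rfl | hm
        · exact absurd hiI hαI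
        · have hmI : α - i ∉ Submodule.span ℝ I :=
            fun h' => hαI (by simpa using add_mem h' hiI)
          have h1 := hstep _ hm hmI i hi (by simpa using hα.1)
          rw [sub_add_cancel] at h1
          rw [h1]
          refine ih hm hβ hmI P Q hP' hQ ?_ hβI (by omega)
          rw [sub_add_eq_add_sub, h]
          abel
      · have hm := (hR.add_mem_of_neg _ hβ.1 _ (hS.subset (hI hi)) (by linarith)).resolve_left
          (hR.add_ne_zero hS hβ (hS.mem_posRoots (hI hi)))
        rw [← hstep _ hβ hβI i hi hm]
        refine ih hα (add_mem_posRoots hβ (hS.mem_posRoots (hI hi)) hm) hαI P Q hP' hQ ?_ ?_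
          (by omega)
        · rw [h]; abel
        · exact fun h' => hβI (by simpa using sub_mem h' hiI)
    by_cases hγ : α - β = 0
    · rw [sub_eq_zero.1 hγ]
    have hsum : ∀ (z : V) (M : Multiset V), (∀ i ∈ M, B z i ≤ 0) → B z M.sum ≤ 0 := by
      intro z M hM
      induction M using Multiset.induction_on with
      | empty => simp
      | cons a M ih =>
        rw [Multiset.sum_cons, map_add]
        exact add_nonpos (hM a (Multiset.mem_cons_self a M))
          (ih fun i hi => hM i (Multiset.mem_cons_of_mem hi))
    have hpos := hR.pos _ hγ
    have e : α - β = P.sum - Q.sum := by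
      rw [sub_eq_sub_iff_add_eq_add, h]; abel
    by_cases h1 : ∀ i ∈ P, B (α - β) i ≤ 0
    · by_cases h2 : ∀ i ∈ Q, B (β - α) i ≤ 0
      · exfalso
        have g1 := hsum _ P h1
        have g2 := hsum _ Q h2
        have g3 : B (α - β) (P.sum - Q.sum) = B (α - β) P.sum + B (β - α) Q.sum := by
          rw [← neg_sub α β, map_neg, LinearMap.neg_apply, map_sub, sub_eq_add_neg]
        rw [← e] at g3
        linarith
      · push Not at h2
        obtain ⟨i, hi, hlt⟩ := h2
        exact (key hβ hα hβI hαI Q P hQ hP h.symm (by omega) i hi hlt).symm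
    · push Not at h1
      obtain ⟨i, hi, hlt⟩ := h1
      exact key hα hβ hαI hβI P Q hP hQ h hn i hi hlt

/-- Outside the span of the support of a colour `d`, adding a simple root of that support does not
change the colour. Otherwise, the existence of roots `p` and `p + u` outside this span with the two
given colours would propagate from `u = i` to some `u` of colour `d`. -/
lemma colour_add_simple (hR : IsRootLike B R) (hS : IsBase R S) (hc : IsColouring R S c) {d : κ}
    {a i : V} (ha : a ∈ posRoots R S) (haI : a ∉ Submodule.span ℝ (colourSupport hS c d))
    (hi : i ∈ colourSupport hS c d) (hai : a + i ∈ R) : c (a + i) = c a := by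
  have hI := colourSupport_subset hS c d
  obtain ⟨hiS, hy⟩ := id hi
  by_contra hne
  set W := Submodule.span ℝ (colourSupport hS c d)
  have hd : ∀ z ∈ posRoots R S, z ∉ W → c z ≠ d :=
    fun z hz hzW hcz => hzW (mem_span_colourSupport hS hz hcz)
  let Good : V → Prop := fun u => u ∈ W ∧ ∃ p ∈ posRoots R S, p ∉ W ∧ c p = c a ∧ p + u ∈ R ∧
    c (p + u) = c (a + i)
  have step : ∀ u ∈ posRoots R S, ∀ v ∈ posRoots R S, c v = d → u + v ∈ posRoots R S →
      (∃ y ∈ posRoots R S, c y = d ∧ hS.height (u + v) ≤ hS.height y) → Good u → Good (u + v) := by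
    rintro u hu v hv hvd huv - ⟨huW, p, hp, hpW, hpe, hpu, hpf⟩
    have hvW : v ∈ W := mem_span_colourSupport hS hv hvd
    refine ⟨add_mem huW hvW, ?_⟩
    have hpu' := add_mem_posRoots hp hu hpu
    by_cases hz : p + u + v ∈ R
    · refine ⟨p, hp, hpW, hpe, by rwa [← add_assoc], ?_⟩
      rw [← add_assoc]
      rcases hc _ hpu' v hv hz with h | h
      · rw [h, hpf]
      · refine absurd (h.trans hvd) (hd _ (add_mem_posRoots hpu' hv hz) fun h' => hpW ?_)
        have e : p = p + u + v - u - v := by abel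
        rw [e]
        exact sub_mem (sub_mem h' huW) hvW
    · have h4 := hR.sub_mem_of_add_notMem hp.1 hu.1 hv.1 hpu huv.1
        (by rintro (h | h); exacts [hR.add_ne_zero hS hpu' hv h, hz h])
      rcases hR.eq_or_sub_mem_or_sub_mem hS h4 with rfl | h | h
      · exact absurd hvW hpW
      · have e : p - v + v = p := by abel
        have e' : p - v + (u + v) = p + u := by abel
        refine ⟨p - v, h, fun h' => hpW ?_, ?_, by rwa [e'], by rwa [e']⟩
        · rw [← e]; exact add_mem h' hvW
        · rcases hc _ h v hv (by rw [e]; exact hp.1) with h' | h'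
          · rw [e] at h'; rw [← h', hpe]
          · rw [e] at h'
            exact absurd (h'.trans hvd) (hd p hp hpW)
      · refine absurd (hS.mem_span_of_add_mem_span hI hp.2 h.2 ?_) hpW
        rwa [add_sub_cancel]
  obtain ⟨y, hy, hyd, hyW, p, hp, hpW, hpe, hpy, hpf⟩ := hR.exists_of_colour hS hc ⟨i, hiS⟩ hy
    (Good := Good) ⟨Submodule.subset_span hi, a, ha, haI, rfl, hai, rfl⟩ step
  rcases hc p hp y hy hpy with h | h
  · exact hne (by rw [← hpf, h, hpe])
  · refine hd _ (add_mem_posRoots hp hy hpy) (fun h' => hpW ?_) (h.trans hyd)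
    simpa using sub_mem h' hyW

/-! ### Roots of maximal height -/

/-- Let `x` be a root of maximal height among those not of colour `k`. If `x + s` is a root for a
simple root `s`, then `s` occurs in no root of a third colour `d`. Otherwise, the existence of a
root `p` of the colour of `x` for which `p + u` is a root higher than `x` would propagate from
`u = s` to some `u` of colour `d`; but then `p + u` has neither the colour `k` nor a height that is
allowed for the other colours. -/
lemma notMem_colourSupport (hR : IsRootLike B R) (hS : IsBase R S) (hc : IsColouring R S c)
    {k d : κ} {x s : V} (hx : x ∈ posRoots R S) (hxk : c x ≠ k)
    (hmax : ∀ z ∈ posRoots R S, c z ≠ k → hS.height z ≤ hS.height x) (hs : s ∈ S)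
    (hxs : x + s ∈ R) (hdk : d ≠ k) (hdx : d ≠ c x) : s ∉ colourSupport hS c d := by
  rintro ⟨_, hy⟩
  let Good : V → Prop := fun u => ∃ p ∈ posRoots R S, c p = c x ∧ p + u ∈ R ∧
    hS.height x < hS.height (p + u)
  have step : ∀ u ∈ posRoots R S, ∀ v ∈ posRoots R S, c v = d → u + v ∈ posRoots R S →
      (∃ y ∈ posRoots R S, c y = d ∧ hS.height (u + v) ≤ hS.height y) → Good u → Good (u + v) := by
    rintro u hu v hv hvd huv ⟨y, hy, hyd, hle⟩ ⟨p, hp, hpx, hpu, hlt⟩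
    have hpu' := add_mem_posRoots hp hu hpu
    by_cases hz : p + u + v ∈ R
    · refine ⟨p, hp, hpx, by rwa [← add_assoc], ?_⟩
      rw [← add_assoc, map_add]
      linarith [hR.height_ge_one hS hv]
    · have h4 := hR.sub_mem_of_add_notMem hp.1 hu.1 hv.1 hpu huv.1
        (by rintro (h | h); exacts [hR.add_ne_zero hS hpu' hv h, hz h])
      rcases hR.eq_or_sub_mem_or_sub_mem hS h4 with rfl | h | h
      · exact absurd (hvd.symm.trans hpx) hdx
      · have e : p - v + v = p := by abel
        have e' : p - v + (u + v) = p + u := by abel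
        refine ⟨p - v, h, ?_, by rwa [e'], by rwa [e']⟩
        rcases hc _ h v hv (by rw [e]; exact hp.1) with h' | h'
        · rw [e] at h'; rw [← h', hpx]
        · rw [e] at h'
          exact absurd (hvd.symm.trans (h'.symm.trans hpx)) hdx
      · exfalso
        have h1 := hmax y hy (hyd ▸ hdk)
        have h2 := hR.height_ge_one hS h
        have e : u + v = p + u + (v - p) := by abel
        rw [e, map_add] at hle
        linarith
  obtain ⟨y, hy, hyd, p, hp, hpx, hpy, hlt⟩ := hR.exists_of_colour hS hc ⟨s, hs⟩ hy
    (Good := Good) ⟨x, hx, rfl, hxs, by rw [map_add, hS.height_simple hs]; linarith⟩ step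
  refine (hmax _ (add_mem_posRoots hp hy hpy) ?_).not_gt hlt
  rcases hc p hp y hy hpy with h | h
  · rwa [h, hpx]
  · rwa [h, hyd]

end IsRootLike

/-- If a linear functional is nonnegative on the simple roots occurring in `y` but not positive at
`y`, then it vanishes on these simple roots. -/
lemma IsBase.eq_zero_of_coord_pos (hS : IsBase R S) {y : V} (hy : y ∈ AddSubmonoid.closure S)
    (f : V →ₗ[ℝ] ℝ) (hf : ∀ t : S, 0 < hS.coord t y → 0 ≤ f t) (hfy : f y ≤ 0) (s : S)
    (hs : 0 < hS.coord s y) : f s = 0 := by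
  have key : (∀ t : S, 0 < hS.coord t y → 0 ≤ f t) →
      0 ≤ f y ∧ (f y ≤ 0 → ∀ s : S, 0 < hS.coord s y → f s = 0) := by
    clear hf hfy hs
    induction hy using AddSubmonoid.closure_induction with
    | mem t ht =>
      intro hf
      have h0 : 0 ≤ f t := hf ⟨t, ht⟩ (by rw [hS.coord_self ⟨t, ht⟩]; exact one_pos)
      refine ⟨h0, fun h s hs => ?_⟩
      by_cases hts : (⟨t, ht⟩ : S) = s
      · rw [← hts]; exact le_antisymm h h0
      · exact absurd hs (hS.coord_of_ne hts).not_gt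
    | zero => simp
    | add a b ha hb iha ihb =>
      intro hf
      obtain ⟨a1, a2⟩ := iha fun t ht => hf t (hS.coord_pos_of_add t ht hb)
      obtain ⟨b1, b2⟩ := ihb fun t ht => hf t (add_comm b a ▸ hS.coord_pos_of_add t ht ha)
      rw [map_add]
      refine ⟨add_nonneg a1 b1, fun h s hs => ?_⟩
      by_cases hsa : 0 < hS.coord s a
      · exact a2 (by linarith) s hsa
      · refine b2 (by linarith) s ?_
        rw [map_add] at hs
        linarith
  exact (key hf).2 hfy s hs

namespace IsRootLike

lemma form_nonpos_of_ne (hR : IsRootLike B R) (hS : IsBase R S) {s t : V} (hs : s ∈ S)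
    (ht : t ∈ S) (hst : s ≠ t) : B s t ≤ 0 := by
  by_contra h
  rcases hR.sub_simple_mem hS (hS.mem_posRoots hs) ht
    (hR.sub_mem_of_pos (hS.subset hs) (hS.subset ht) (not_le.1 h)) with h | h
  · exact hst h
  · have := hR.height_ge_one hS h
    rw [map_sub, hS.height_simple hs, hS.height_simple ht] at this
    norm_num at this

/-- If the base splits into two orthogonal parts, so does the set of positive roots. -/
lemma mem_span_or_mem_span_sdiff (hR : IsRootLike B R) (hS : IsBase R S) {A : Set V} (hA : A ⊆ S)
    (horth : ∀ s ∈ A, ∀ t ∈ S \ A, B s t = 0) {y : V} (hy : y ∈ posRoots R S) :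
    y ∈ Submodule.span ℝ A ∨ y ∈ Submodule.span ℝ (S \ A) := by
  have key : ∀ T ⊆ S, ∀ y ∈ posRoots R S, y ∈ Submodule.span ℝ T → ∀ t ∈ S, t ∉ T →
      (∀ s ∈ T, B s t = 0) → y + t ∉ R := by
    -- If `y` is orthogonal to `t`, then `y - t` would be a root or zero as well, although its
    -- coefficient at `t` is `-1` and it has positive coefficients elsewhere.
    intro T hT y hy hyT t ht htT horth hyt
    have h0 : B y t = 0 := by
      have : Submodule.span ℝ T ≤ LinearMap.ker (B.flip t) :=
        Submodule.span_le.2 fun s hs => horth s hs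
      exact this hyT
    have hcoord := (hS.mem_span_iff hT).1 hyT ⟨t, ht⟩ htT
    rcases hR.sub_simple_mem hS hy ht (hR.sub_mem_of_orthogonal y hy.1 t (hS.subset ht) h0 hyt)
      with rfl | h
    · rw [hS.coord_self ⟨y, ht⟩] at hcoord
      exact one_ne_zero hcoord
    · have h1 := hS.coord_nonneg ⟨t, ht⟩ h.2
      rw [map_sub, hcoord, hS.coord_self ⟨t, ht⟩] at h1
      norm_num at h1
  refine hR.posRoots_induction hS
    (p := fun y => y ∈ Submodule.span ℝ A ∨ y ∈ Submodule.span ℝ (S \ A)) ?_ ?_ hy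
  · intro s hs
    by_cases hsA : s ∈ A
    · exact Or.inl (Submodule.subset_span hsA)
    · exact Or.inr (Submodule.subset_span ⟨hs, hsA⟩)
  · rintro y hy t ht hyt ih
    by_cases htA : t ∈ A
    · rcases ih with h | h
      · exact Or.inl (add_mem h (Submodule.subset_span htA))
      · exact absurd hyt.1 (key _ Set.sdiff_subset y hy h t ht (fun h' => h'.2 htA)
          fun s hs => by rw [hR.symm]; exact horth t htA s hs)
    · rcases ih with h | h
      · exact absurd hyt.1 (key A hA y hy h t ht htA fun s hs => horth s hs t ⟨ht, htA⟩)
      · exact Or.inr (add_mem h (Submodule.subset_span ⟨ht, htA⟩))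

/-- If a colouring of the positive roots takes at least three colours, then some nonempty proper
subset `I` of the base is such that the colour of a root outside `span I` depends only on its
class modulo `span I`.

Let `θ` be a highest root and `x` a highest root of a colour other than that of `θ`. If some `x + s`
is a root, the support of a third colour is a proper subset by `notMem_colourSupport` and has the
required property. If not, then `x` is dominant and orthogonal to `θ`, so the simple roots that
occur in `θ` form a component of the base. -/
theorem exists_subset_colour_eq (hR : IsRootLike B R) (hS : IsBase R S) (hc : IsColouring R S c)
    (h3 : ∀ k l : κ, ∃ y ∈ posRoots R S, c y ≠ k ∧ c y ≠ l) :
    ∃ I ⊆ S, I ≠ ∅ ∧ I ≠ S ∧ ∀ α ∈ posRoots R S, ∀ β ∈ posRoots R S,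
      α ∉ Submodule.span ℝ I → α - β ∈ Submodule.span ℝ I → c α = c β := by
  have hempty : ∀ y ∈ posRoots R S, y ∉ Submodule.span ℝ (∅ : Set V) := by
    intro y hy h
    rw [Submodule.span_empty, Submodule.mem_bot] at h
    exact hR.ne_zero hy.1 h
  have hne : ∃ y ∈ posRoots R S, True := by
    by_contra! h
    have hκ : Nonempty κ := ⟨c 0⟩
    obtain ⟨y, hy, -⟩ := h3 hκ.some hκ.some
    exact (h y hy)
  obtain ⟨θ, hθ, -, hθmax⟩ := hR.exists_max_height hS hne
  obtain ⟨x, hx, hxk, hxmax⟩ := hR.exists_max_height hS (p := fun y => c y ≠ c θ)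
    ((h3 (c θ) (c θ)).imp fun y h => ⟨h.1, h.2.1⟩)
  by_cases hadd : ∃ s ∈ S, x + s ∈ R
  · obtain ⟨s, hs, hxs⟩ := hadd
    obtain ⟨y, hy, hyk, hyx⟩ := h3 (c θ) (c x)
    have hI := colourSupport_subset hS c (c y)
    refine ⟨colourSupport hS c (c y), hI, fun h => ?_, fun h => ?_, ?_⟩
    · exact hempty y hy (h ▸ mem_span_colourSupport hS hy rfl)
    · have := hR.notMem_colourSupport hS hc hx hxk hxmax hs hxs hyk hyx
      rw [h] at this
      exact this hs
    · intro α hα β hβ hαI hαβ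
      exact hR.colour_eq_of_sub_mem_span hS hI
        (fun a ha haI i hi hai => hR.colour_add_simple hS hc ha haI hi hai) hα hβ hαI hαβ
  · -- In this case both `x` and `θ` have nonnegative product with all simple roots.
    push Not at hadd
    have hxβ : ∀ β ∈ posRoots R S, x + β ∉ R := by
      intro β hβ
      refine hR.posRoots_induction hS (p := fun β => x + β ∉ R) hadd ?_ hβ
      rintro y hy t ht hyt ih h
      have e : y + t + x = x + (y + t) := by abel
      rcases hR.add_mem_or_add_mem hy.1 (hS.subset ht) hx.1 hyt.1 (e.symm ▸ h) with h | h
      · exact ih (add_comm y x ▸ h.resolve_left (hR.add_ne_zero hS hy hx))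
      · exact hadd t ht
          (add_comm t x ▸ h.resolve_left (hR.add_ne_zero hS (hS.mem_posRoots ht) hx))
    have hBx : ∀ s ∈ S, 0 ≤ B x s := by
      intro s hs
      by_contra h
      exact hadd s hs ((hR.add_mem_of_neg x hx.1 s (hS.subset hs) (not_le.1 h)).resolve_left
        (hR.add_ne_zero hS hx (hS.mem_posRoots hs)))
    have hBθ : ∀ s ∈ S, 0 ≤ B s θ := by
      intro s hs
      by_contra h
      rw [hR.symm] at h
      have h1 := (hR.add_mem_of_neg θ hθ.1 s (hS.subset hs) (not_le.1 h)).resolve_left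
        (hR.add_ne_zero hS hθ (hS.mem_posRoots hs))
      have h2 := hθmax _ (add_mem_posRoots hθ (hS.mem_posRoots hs) h1) trivial
      rw [map_add, hS.height_simple hs] at h2
      linarith
    have hxθ : B x θ ≤ 0 := by
      by_contra h
      rcases hR.eq_or_sub_mem_or_sub_mem hS (hR.sub_mem_of_pos hx.1 hθ.1 (not_le.1 h)) with h | h | h
      · exact hxk (congrArg c h)
      · have h1 := hR.height_ge_one hS h
        rw [map_sub] at h1
        linarith [hθmax x hx trivial]
      · exact hxβ _ h (by rw [add_sub_cancel]; exact hθ.1)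
    set A : Set V := {s | ∃ hs : s ∈ S, 0 < hS.coord ⟨s, hs⟩ θ}
    have hA : A ⊆ S := fun s hs => hs.1
    have hθA : θ ∈ Submodule.span ℝ A := by
      rw [hS.mem_span_iff hA]
      intro s hs
      by_contra h
      exact hs ⟨s.2, lt_of_le_of_ne (hS.coord_nonneg s hθ.2) (Ne.symm h)⟩
    have horth : ∀ s ∈ A, ∀ t ∈ S \ A, B s t = 0 := by
      rintro s ⟨hs, hsθ⟩ t ⟨ht, htA⟩
      have h := hS.eq_zero_of_coord_pos hθ.2 (-B t) (fun r hr => ?_) ?_ ⟨s, hs⟩ hsθ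
      · rw [hR.symm]
        simpa using h
      · rw [LinearMap.neg_apply, Left.nonneg_neg_iff]
        refine hR.form_nonpos_of_ne hS ht r.2 ?_
        rintro rfl
        exact htA ⟨ht, hr⟩
      · rw [LinearMap.neg_apply, Left.neg_nonpos_iff]
        exact hBθ t ht
    refine ⟨A, hA, fun h => hempty θ hθ (h ▸ hθA), fun h => ?_, ?_⟩
    · obtain ⟨t, ht, hpos⟩ := hR.exists_simple_pos hx
      obtain ⟨_, htθ⟩ : t ∈ A := h ▸ ht
      have h0 := hS.eq_zero_of_coord_pos hθ.2 (B x) (fun r _ => hBx r r.2) hxθ ⟨t, ht⟩ htθ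
      exact hpos.ne' h0
    · intro α hα β hβ hαA hαβ
      have hβA : β ∉ Submodule.span ℝ A := fun h => hαA (by simpa using add_mem hαβ h)
      have h1 := (hR.mem_span_or_mem_span_sdiff hS hA horth hα).resolve_left hαA
      have h2 := (hR.mem_span_or_mem_span_sdiff hS hA horth hβ).resolve_left hβA
      rw [sub_eq_zero.1 (hS.eq_zero_of_mem_span hA hαβ (sub_mem h1 h2))]

/-! ### Primitive inversion sets -/

/-- The decomposition of `Φ` into two nonempty inversion sets gives a colouring with three colours,
and the subset of the base obtained from it exhibits `Φ` as an inflation. -/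
theorem isIrreducible (hR : IsRootLike B R) (hS : IsBase R S) {Φ : Set V}
    (hΦ : IsInversionSet R S Φ) (hprim : IsPrimitive R S Φ) : IsIrreducible R S Φ := by
  classical
  refine ⟨Set.nonempty_iff_ne_empty.2 hprim.ne_empty, hΦ, fun Φ₁ Φ₂ h₁ h₂ hdisj hU => ?_⟩
  by_contra hcon
  obtain ⟨hn1, hn2⟩ := not_or.1 hcon
  have hd : ∀ z, z ∈ Φ₁ → z ∉ Φ₂ := fun z hz hz' => Set.disjoint_left.1 hdisj hz hz'
  have hmem : ∀ z, z ∈ Φ ↔ z ∈ Φ₁ ∨ z ∈ Φ₂ := fun z => by rw [hU]; rfl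
  obtain ⟨z₂, hz₂⟩ : Φ₂.Nonempty := by
    rw [Set.nonempty_iff_ne_empty]
    rintro rfl
    exact hn1 (by rw [hU, Set.union_empty])
  obtain ⟨z₁, hz₁⟩ : Φ₁.Nonempty := by
    rw [Set.nonempty_iff_ne_empty]
    rintro rfl
    exact hn2 (by rw [hU, Set.empty_union])
  obtain ⟨z₀, hz₀, hz₀'⟩ : ∃ z ∈ posRoots R S, z ∉ Φ := by
    by_contra! h
    exact hprim.ne_posRoots (Set.Subset.antisymm hΦ.subset h)
  -- Colour the two parts of `Φ` and the complement of `Φ`.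
  let c : V → ℕ := fun z => if z ∈ Φ₁ then 1 else if z ∈ Φ₂ then 2 else 0
  have hcΦ : ∀ z, c z = 0 ↔ z ∉ Φ := by
    intro z
    rw [hmem]
    by_cases a : z ∈ Φ₁ <;> by_cases b : z ∈ Φ₂ <;> simp [c, a, b]
  have hc : IsColouring R S c := by
    intro α hα β hβ hαβ
    have q1 := fun ha hb => h₁.coclosed α ⟨hα, ha⟩ β ⟨hβ, hb⟩ hαβ
    have q2 := fun ha hb => h₂.coclosed α ⟨hα, ha⟩ β ⟨hβ, hb⟩ hαβ
    have q3 := fun ha hb => hΦ.closed α ha β hb hαβ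
    have p1 := fun ha hb => h₁.closed α ha β hb hαβ
    have p2 := fun ha hb => h₂.closed α ha β hb hαβ
    simp only [Set.mem_sdiff, hmem] at q1 q2 q3
    have d1 := hd α
    have d2 := hd β
    have d3 := hd (α + β)
    simp only [c]
    grind
  obtain ⟨I, hI, hI0, hIS, hIc⟩ := hR.exists_subset_colour_eq hS hc (fun k l => by
    have c1 : c z₁ = 1 := by simp [c, hz₁]
    have c2 : c z₂ = 2 := by simp [c, hz₂, show z₂ ∉ Φ₁ from fun h => hd z₂ h hz₂]
    have c0 : c z₀ = 0 := (hcΦ z₀).2 hz₀'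
    by_contra! h
    have e0 := h z₀ hz₀
    have e1 := h z₁ (h₁.subset hz₁)
    have e2 := h z₂ (h₂.subset hz₂)
    rw [c0] at e0
    rw [c1] at e1
    rw [c2] at e2
    omega)
  have hinf : Φ = inflation R S I (quotientSet Φ I) (Φ ∩ Submodule.span ℝ I) := by
    ext z
    constructor
    · intro hz
      by_cases hzI : z ∈ Submodule.span ℝ I
      · exact Or.inr ⟨hz, hzI⟩
      · refine Or.inl ⟨hΦ.subset hz, fun h => hzI ?_, z, hz, rfl⟩
        simpa using h
    · rintro (⟨hz, hz0, a, ha, haz⟩ | hz)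
      · have hsub : z - a ∈ Submodule.span ℝ I := by
          rw [← Submodule.ker_mkQ (Submodule.span ℝ I), LinearMap.mem_ker, map_sub, haz, sub_self]
        have h := hIc z hz a (hΦ.subset ha) (fun h => hz0 (by simpa using h)) hsub
        by_contra hzΦ
        exact (hcΦ a).1 (h ▸ (hcΦ z).2 hzΦ) ha
      · exact hz.1
  rcases hprim.eq_or_eq I hI (quotientSet Φ I)
    (fun x hx => ⟨hx.1, hx.2.imp fun a ha => ⟨hΦ.subset ha.1, ha.2⟩⟩)
    (Φ ∩ Submodule.span ℝ I) (Set.inter_subset_inter_left _ hΦ.subset) hinf with h | h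
  · exact hI0 h
  · exact hIS h

end IsRootLike

end RootLike

section QuotientForm

/-! ### Quotient root systems -/

variable {ι E E' : Type*} [AddCommGroup E] [Module ℝ E] [AddCommGroup E'] [Module ℝ E']
  (P : RootPairing ι ℝ E E') (J : Set ι)

lemma root_sub_root_mem_of_rootForm_pos [Fintype ι] [P.IsCrystallographic] {i j : ι}
    (h : 0 < P.RootForm (P.root i) (P.root j)) :
    P.root i - P.root j = 0 ∨ P.root i - P.root j ∈ Set.range P.root := by
  have h1 : 2 * P.RootForm (P.root i) (P.root j)
      = P.pairing i j * P.RootForm (P.root j) (P.root j) :=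
    (P.posRootForm ℝ).two_mul_apply_root_root i j
  have h2 : 0 < P.pairing i j :=
    pos_of_mul_pos_left (by rw [← h1]; linarith) (P.zero_le_rootForm (P.root j))
  rw [← P.algebraMap_pairingIn ℤ] at h2
  have h3 : 0 < P.pairingIn ℤ i j := by simpa using h2
  by_cases hij : i = j
  · left; rw [hij, sub_self]
  · exact Or.inr (P.root_sub_root_mem_of_pairingIn_pos h3 hij)

/-- The orthogonal complement with respect to the canonical form provides a section of the
projection modulo the span of some roots. -/
lemma exists_orthogonal_section [Fintype ι] [P.IsRootSystem] (Q : Submodule ℝ E) :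
    ∃ σ : E ⧸ Q →ₗ[ℝ] E, (∀ x, Q.mkQ (σ x) = x) ∧ ∀ x, ∀ q ∈ Q, P.RootForm q (σ x) = 0 := by
  have hfd : FiniteDimensional ℝ E :=
    ⟨RootPairing.IsRootSystem.span_root_eq_top (P := P) ▸
      Submodule.fg_span (Set.finite_range P.root)⟩
  have hcompl : IsCompl Q (P.RootForm.orthogonal Q) := by
    rw [LinearMap.BilinForm.isCompl_orthogonal_iff_disjoint P.rootForm_symmetric.isRefl,
      Submodule.disjoint_def]
    exact fun x hx hx' => P.rootForm_anisotropic x (hx' x hx)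
  refine ⟨(P.RootForm.orthogonal Q).subtype ∘ₗ
    (Q.quotientEquivOfIsCompl _ hcompl).toLinearMap, fun x => ?_, fun x q hq => ?_⟩
  · exact Submodule.mk_quotientEquivOfIsCompl_apply hcompl x
  · exact (Q.quotientEquivOfIsCompl _ hcompl x).2 q hq

variable {P J}

/-- The sum of the roots in a coset of `Q` is fixed by the reflections in the roots of `J`, so it
is orthogonal to `Q`. -/
lemma sum_fibre [Fintype ι] [P.IsRootSystem] {Q : Submodule ℝ E}
    (hQ : Q = Submodule.span ℝ (P.root '' J)) {σ : E ⧸ Q →ₗ[ℝ] E}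
    (hσ : ∀ x, Q.mkQ (σ x) = x) (horth : ∀ x, ∀ q ∈ Q, P.RootForm q (σ x) = 0)
    (α : E ⧸ Q) (F : Finset ι) (hF : ∀ i, i ∈ F ↔ Q.mkQ (P.root i) = α) :
    ∑ i ∈ F, P.root i = F.card • σ α := by
  have hmk : Q.mkQ (∑ i ∈ F, P.root i) = F.card • α := by
    rw [map_sum, Finset.sum_congr rfl fun i hi => (hF i).1 hi, Finset.sum_const]
  have hfix : ∀ j ∈ J, P.reflection j (∑ i ∈ F, P.root i) = ∑ i ∈ F, P.root i := by
    intro j hj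
    have hperm : ∀ i, P.reflectionPerm j i ∈ F ↔ i ∈ F := by
      intro i
      have : Q.mkQ (P.root j) = 0 := by
        simpa [hQ] using Submodule.subset_span (Set.mem_image_of_mem P.root hj)
      rw [hF, hF, P.root_reflectionPerm, P.reflection_apply, map_sub, map_smul, this, smul_zero,
        sub_zero]
    rw [map_sum]
    refine Finset.sum_equiv (P.reflectionPerm j) (fun i => (hperm i).symm) fun i _ => ?_
    rw [P.root_reflectionPerm]
  have hperp : ∀ q ∈ Q, P.RootForm q (∑ i ∈ F, P.root i) = 0 := by
    have hle : Q ≤ LinearMap.ker (P.RootForm.flip (∑ i ∈ F, P.root i)) := by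
      rw [hQ, Submodule.span_le]
      rintro _ ⟨j, hj, rfl⟩
      have h := P.rootForm_reflection_reflection_apply j (P.root j) (∑ i ∈ F, P.root i)
      rw [hfix j hj, P.reflection_apply_self, map_neg, LinearMap.neg_apply] at h
      exact self_eq_neg.1 h.symm
    exact fun q hq => hle hq
  have hmem : ∑ i ∈ F, P.root i - F.card • σ α ∈ Q := by
    refine (Submodule.Quotient.mk_eq_zero Q).1 ?_
    change Q.mkQ _ = 0
    rw [map_sub, hmk, map_nsmul, hσ, sub_self]
  refine sub_eq_zero.1 (P.rootForm_anisotropic _ ?_)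
  change P.RootForm _ _ = 0
  conv_lhs => rw [map_sub, map_nsmul]
  rw [hperp _ hmem, horth _ _ hmem, smul_zero, sub_zero]

/-- A quotient root system satisfies the properties used in the combinatorial part of the argument.
The inner product is the canonical form restricted to the orthogonal complement of the span of
`J`. The product of two classes is the mean of the products of the representatives of the first
one with a fixed representative of the second one, so that positivity can be lifted to
representatives. -/
theorem exists_isRootLike [Finite ι] [P.IsRootSystem] [P.IsCrystallographic] {Q : Submodule ℝ E}
    (hQ : Q = Submodule.span ℝ (P.root '' J)) {R : Set (E ⧸ Q)}
    (hR : R = {x | x ≠ 0 ∧ ∃ a ∈ Set.range P.root, Q.mkQ a = x}) : ∃ B, IsRootLike B R := by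
  classical
  have : Fintype ι := Fintype.ofFinite ι
  obtain ⟨σ, hσ, horth⟩ := exists_orthogonal_section P Q
  have hsum := sum_fibre hQ hσ horth
  subst hR
  set R : Set (E ⧸ Q) := {x | x ≠ 0 ∧ ∃ a ∈ Set.range P.root, Q.mkQ a = x}
  have hsymm : ∀ x y, P.RootForm x y = P.RootForm y x := fun x y => by
    simpa using P.rootForm_symmetric.eq x y
  let π : ι → E ⧸ Q := fun i => Q.mkQ (P.root i)
  let B : LinearMap.BilinForm ℝ (E ⧸ Q) := P.RootForm.compl₁₂ σ σ
  have hB : ∀ x y, B x y = P.RootForm (σ x) (σ y) := fun x y => rfl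
  have hmem : ∀ z, (z = 0 ∨ z ∈ Set.range P.root) → Q.mkQ z = 0 ∨ Q.mkQ z ∈ R := by
    rintro z (rfl | hz)
    · exact Or.inl (map_zero _)
    · exact or_iff_not_imp_left.2 fun h => ⟨h, z, hz, rfl⟩
  have hlift : ∀ x ∈ R, ∃ i, π i = x := by
    rintro x ⟨-, _, ⟨i, rfl⟩, hi⟩
    exact ⟨i, hi⟩
  have hmean : ∀ i k, ∑ j with π j = π i, P.RootForm (P.root j) (P.root k)
      = (Finset.univ.filter fun j => π j = π i).card * B (π i) (π k) := by
    intro i k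
    have h1 := hsum (π i) (Finset.univ.filter fun j => π j = π i) (fun j => Finset.mem_filter_univ j)
    have h2 : P.root k - σ (π k) ∈ Q := by
      refine (Submodule.Quotient.mk_eq_zero Q).1 ?_
      change Q.mkQ _ = 0
      rw [map_sub, hσ, sub_self]
    have h3 := horth (π i) _ h2
    rw [map_sub, LinearMap.sub_apply, sub_eq_zero, hsymm, hsymm (σ (π k))] at h3
    rw [hB, ← h3, ← nsmul_eq_mul, ← LinearMap.smul_apply, ← map_nsmul, ← h1, map_sum,
      LinearMap.sum_apply]
  have hcard : ∀ i, 0 < ((Finset.univ.filter fun j => π j = π i).card : ℝ) := fun i =>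
    Nat.cast_pos.2 (Finset.card_pos.2 ⟨i, by simp⟩)
  have hpos : ∀ i k, 0 < B (π i) (π k) →
      ∃ j, π j = π i ∧ 0 < P.RootForm (P.root j) (P.root k) := by
    intro i k h
    by_contra! hcon
    have h1 := Finset.sum_nonpos fun j (hj : j ∈ Finset.univ.filter fun j => π j = π i) =>
      hcon j (Finset.mem_filter.1 hj).2
    rw [hmean] at h1
    exact h1.not_gt (mul_pos (hcard i) h)
  have hneg : ∀ i k, B (π i) (π k) = 0 → P.RootForm (P.root i) (P.root k) < 0 →
      ∃ j, π j = π i ∧ 0 < P.RootForm (P.root j) (P.root k) := by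
    intro i k h hik
    by_contra! hcon
    have h1 := Finset.sum_neg' (s := Finset.univ.filter fun j => π j = π i)
      (f := fun j => P.RootForm (P.root j) (P.root k))
      (fun j hj => hcon j (Finset.mem_filter.1 hj).2) ⟨i, by simp, hik⟩
    rw [hmean, h, mul_zero] at h1
    exact h1.false
  have hnegR : ∀ a ∈ R,
      -a ∈ R := by
    rintro _ ⟨h0, _, ⟨i, rfl⟩, rfl⟩
    refine ⟨neg_ne_zero.2 h0, P.root (P.reflectionPerm i i), ⟨_, rfl⟩, ?_⟩
    rw [P.root_reflectionPerm, P.reflection_apply_self, map_neg]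
  have hsub : ∀ a ∈ R,
      ∀ b ∈ R, 0 < B a b →
      a - b = 0 ∨ a - b ∈ R := by
    intro a ha b hb h
    obtain ⟨i, rfl⟩ := hlift a ha
    obtain ⟨k, rfl⟩ := hlift b hb
    obtain ⟨j, hj, hjk⟩ := hpos i k h
    have := hmem _ (root_sub_root_mem_of_rootForm_pos P hjk)
    rwa [map_sub, show Q.mkQ (P.root j) = π i from hj] at this
  refine ⟨B, ⟨?_, fun h => h.1 rfl, hnegR, fun x y => hsymm _ _, fun x hx => ?_, ?_, ?_⟩⟩
  · exact ((Set.finite_range P.root).image Q.mkQ).subset fun x hx => hx.2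
  · refine P.rootForm_pos_of_ne_zero (by simp) fun h => hx ?_
    rw [← hσ x, h, map_zero]
  · intro a ha b hb h
    have := hsub a ha (-b) (hnegR b hb) (by simpa using h)
    rwa [sub_neg_eq_add] at this
  · intro a ha b hb h hab
    -- Choose representatives `c` of `a + b` and `i` of `a` whose difference is a root `k`.
    obtain ⟨c, hc⟩ := hlift _ hab
    obtain ⟨i₀, rfl⟩ := hlift a ha
    have h1 : 0 < B (π i₀) (π c) := by
      rw [hc, map_add, h, add_zero, hB]
      refine P.rootForm_pos_of_ne_zero (by simp) fun h => ha.1 ?_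
      rw [← hσ (π i₀), h, map_zero]
    obtain ⟨i, hi, hic⟩ := hpos i₀ c h1
    rw [hsymm] at hic
    rw [← hi] at h hab hc ⊢
    have hbc : Q.mkQ (P.root c - P.root i) = b := by
      rw [map_sub]
      exact sub_eq_of_eq_add' hc
    rcases root_sub_root_mem_of_rootForm_pos P hic with h0 | ⟨k, hk⟩
    · rw [h0, map_zero] at hbc
      exact absurd hbc.symm hb.1
    · obtain rfl : π k = b := by rw [← hbc, ← hk]
      have hfin : ∀ j, π j = π i → P.root j - P.root k = 0 ∨
          P.root j - P.root k ∈ Set.range P.root → π i - π k = 0 ∨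
          π i - π k ∈ R := by
        intro j hj hjk
        have := hmem _ hjk
        rwa [map_sub, show Q.mkQ (P.root j) = π i from hj] at this
      rcases lt_trichotomy (P.RootForm (P.root i) (P.root k)) 0 with hlt | heq | hgt
      · obtain ⟨j, hj, hjk⟩ := hneg i k h hlt
        exact hfin j hj (root_sub_root_mem_of_rootForm_pos P hjk)
      · -- The reflection in `k` maps the root `i + k` to `i - k`.
        have h2 : 2 * P.RootForm (P.root i) (P.root k)
            = P.pairing i k * P.RootForm (P.root k) (P.root k) :=
          (P.posRootForm ℝ).two_mul_apply_root_root i k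
        have h3 : P.pairing i k = 0 := by
          rw [heq, mul_zero, eq_comm, mul_eq_zero] at h2
          exact h2.resolve_right (P.rootForm_pos_of_ne_zero (by simp) (P.ne_zero k)).ne'
        refine hfin i rfl (Or.inr ⟨P.reflectionPerm k c, ?_⟩)
        have h4 : P.root c = P.root i + P.root k := by rw [hk]; abel
        rw [P.root_reflectionPerm, h4, map_add, P.reflection_apply_self, P.reflection_apply_root,
          h3, zero_smul, sub_zero, sub_eq_add_neg]
      · exact hfin i rfl (root_sub_root_mem_of_rootForm_pos P hgt)

end QuotientForm

end QuotientRootSystem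

theorem mainTheorem4 {ι E E' : Type*} [Finite ι]
    [AddCommGroup E] [Module ℝ E] [AddCommGroup E'] [Module ℝ E']
    (P : RootPairing ι ℝ E E') [P.IsRootSystem] [P.IsCrystallographic] [P.IsReduced]
    (b : P.Base) (J : Set ι) (hJ : J ⊂ (b.support : Set ι))
    (R : Set (E ⧸ Submodule.span ℝ (P.root '' J)))
    (hR : R = QuotientRootSystem.quotientSet (Set.range P.root) (P.root '' J))
    (S : Set (E ⧸ Submodule.span ℝ (P.root '' J)))
    (hS : QuotientRootSystem.IsBase R S)
    (Φ : Set (E ⧸ Submodule.span ℝ (P.root '' J)))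
    (hΦ : QuotientRootSystem.IsInversionSet R S Φ)
    (hprim : QuotientRootSystem.IsPrimitive R S Φ) :
    QuotientRootSystem.IsIrreducible R S Φ := by
  obtain ⟨B, hB⟩ := QuotientRootSystem.exists_isRootLike rfl hR
  exact hB.isIrreducible hS hΦ hprim
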